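/- Let $\kappa$ be an infinite cardinal and let $M$ be a $\kappa$-saturated and strongly $\kappa$-homogeneous model of DLO, the theory of dense linear orders without endpoints (for instance a saturated model of cardinality $\kappa$). Let $M^S$ be the following three-sorted structure (the selector expansion). The sort $P$ is a disjoint union of $\kappa$ copies of $M$; $E$ is the equivalence relation on $P$ whose classes are these copies; the second sort is $P/E$, with the quotient map $f_E\colon P\to P/E$; the order is given by the relation $R^+(z,x_1,x_2)$, which says that $x_1,x_2$ lie in the class $z$ and $x_1\le x_2$ there; the third sort $Q$ is the set of all sections $s$ of $f_E$, with the function $\pi\colon P/E\times Q\to P$, $\pi(z,s)=s(z)$. Let $T^S=\mathrm{Th}(M^S)$. Fix an $E$-class $C_0$, identified with $M$, let $a\in C_0$, and let $X=\{x\in C_0 : x>a\}$. Definable and algebraic closure are taken in $(M^S)^{eq}$, and parameters may be imaginary. A definable set $Y$ with canonical parameter $f$ is *weakly normal relative to* a parameter set $A$ if $Y\neq\emptyset$ and $f\in \mathrm{acl}(A,b)$ for every $b\in Y$. A formula $\varphi(x,b)$ *strongly divides over* $A$ if $b\notin\mathrm{acl}(A)$ and, for some $k>0$, the family $\{\varphi(x,b')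 : b'\models \mathrm{tp}(b/A)\}$ is $k$-inconsistent. Then: 1. $a$ is a canonical parameter of $X$ in $M^S$. 2. There is no $e\in\mathrm{dcl}^{eq}(a)$ such that $X$ is weakly normal relative to $e$ and $a\notin\mathrm{acl}(e)$. More generally, there is no set $C\subseteq\mathrm{dcl}^{eq}(a)$ such that $X$ is weakly normal relative to $C$ and $a\notin\mathrm{acl}(C)$; and there is no set $C\subseteq\mathrm{dcl}^{eq}(a)$ such that the formula $x>a$ (in the class of $a$) strongly divides over $C$. 3. There is $d\in Q$ such that $X$ is weakly normal relative to $d$ and $a\notin\mathrm{acl}(d)$, and such that the formula $x>a$ strongly divides over $d$. Consequently the following question has a negative answer: if a definable set $X$ with canonical parameter $e$ is weakly normal relative to some $C$ with $e\notin\mathrm{acl}(C)$, can such a $C$ be found inside $\mathrm{dcl}(e)$? Likewise the following assertion of Ealy and Onshuus (with $C=\emptyset$) fails: if $\varphi(x,b)$ thorn divides over $C$ (that is, strongly divides over some $C'\supseteq C$), then $\varphi(x,b)$ strongly divides over $C,d$ for some tuple $d$ in $\mathrm{dcl}(C,b)$. -/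

import Mathlib

open FirstOrder Cardinal

universe u v w

namespace SelectorTheory

section General

variable (L : FirstOrder.Language.{u, v}) {N : Type w} [L.Structure N]

/-- Definable closure of a parameter set. -/
def dcl (A : Set N) : Set N :=
  {x | A.Definable₁ L ({x} : Set N)}

/-- Algebraic closure of a parameter set. -/
def acl (A : Set N) : Set N :=
  {x | ∃ s : Set N, s.Finite ∧ x ∈ s ∧ A.Definable₁ L s}

/-- `e` is a canonical parameter of `X`: some formula `φ(x, y)` without parameters defines `X` as
`φ(x, e)`, and `e` is the only `y` for which `φ(x, y)` defines `X`. -/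
def IsCanonicalParameter (X : Set N) (e : N) : Prop :=
  ∃ φ : L.Formula (Fin 2),
    {x | φ.Realize ![x, e]} = X ∧ ∀ e' : N, {x | φ.Realize ![x, e']} = X → e' = e

/-- `X` is weakly normal relative to `A`: `X` is nonempty, and its canonical parameter `e` satisfies
`e ∈ acl(A, b)` for every `b ∈ X`. (Canonical parameters are unique up to interdefinability; the
notion is meant for structures with imaginaries, where they exist.) -/
def IsWeaklyNormalOver (X : Set N) (A : Set N) : Prop :=
  X.Nonempty ∧ ∃ e : N, IsCanonicalParameter L X e ∧ ∀ b ∈ X, e ∈ acl L (insert b A)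

/-- `b'` and `b` have the same type over `A`. -/
def SameTypeOver (A : Set N) (b' b : N) : Prop :=
  ∀ s : Set N, A.Definable₁ L s → (b' ∈ s ↔ b ∈ s)

/-- `φ(x, b)` strongly divides over `A`: `b ∉ acl(A)`, and for some `k > 0` the conjugates
`φ(x, b')`, with `b'` realizing the type of `b` over `A`, are `k`-inconsistent. -/
def StronglyDividesOver (φ : L.Formula (Fin 2)) (b : N) (A : Set N) : Prop :=
  b ∉ acl L A ∧ ∃ k : ℕ, 0 < k ∧ ∀ F : Finset N, F.card = k →
    (∀ b' ∈ F, SameTypeOver L A b' b) → ¬ ∃ x : N, ∀ b' ∈ F, φ.Realize ![x, b']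

variable (N)

/-- `κ`-saturation: every set of formulas in one variable over fewer than `κ` parameters which is
finitely satisfiable in `N` is realized in `N`. -/
def IsSaturated (κ : Cardinal.{w}) : Prop :=
  ∀ A : Set N, #A < κ → ∀ p : Set (L[[A]].Formula (Fin 1)),
    (∀ F : Finset (L[[A]].Formula (Fin 1)), (F : Set (L[[A]].Formula (Fin 1))) ⊆ p →
      ∃ x : N, ∀ φ ∈ F, φ.Realize (fun _ => x)) →
    ∃ x : N, ∀ φ ∈ p, φ.Realize (fun _ => x)

/-- Strong `κ`-homogeneity: every partial elementary map of `N` whose domain has fewer than `κ`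
elements extends to an automorphism of `N`. -/
def IsStronglyHomogeneous (κ : Cardinal.{w}) : Prop :=
  ∀ A : Set N, #A < κ → ∀ f : A → N,
    (∀ φ : L.Formula A, φ.Realize (fun x : A => (x : N)) ↔ φ.Realize f) →
    ∃ σ : N ≃[L] N, ∀ x : A, σ (x : N) = f x

/-! ### Imaginaries -/

/-- A sort of imaginaries: an equivalence relation on `n`-tuples, definable without parameters. -/
structure ImaginarySort where
  arity : ℕ
  rel : Setoid (Fin arity → N)
  definable : (∅ : Set N).Definable L
    {v : Fin arity ⊕ Fin arity → N | rel (v ∘ Sum.inl) (v ∘ Sum.inr)}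

/-- The universe of `N^eq`: the elements of `N` together with all classes of all `∅`-definable
equivalence relations on tuples of `N`. -/
inductive WithImaginaries : Type w
  | real (x : N) : WithImaginaries
  | imag (S : ImaginarySort L N) (q : Quotient S.rel) : WithImaginaries

/-- The relation symbols of the language of `N^eq`: a predicate for the home sort, the symbols
of `L` (function symbols through their graphs), and the graph of each quotient map. -/
inductive EqRelations : ℕ → Type (max u v w)
  | home : EqRelations 1
  | rel {n : ℕ} (R : L.Relations n) : EqRelations n
  | graph {n : ℕ} (f : L.Functions n) : EqRelations (n + 1)
  | proj (S : ImaginarySort L N) : EqRelations (S.arity + 1)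

/-- The language of `N^eq`, with all sorts placed in one universe. -/
def eqLanguage : FirstOrder.Language.{0, max u v w} :=
  ⟨fun _ => Empty, EqRelations L N⟩

instance eqStructure : (eqLanguage L N).Structure (WithImaginaries L N) where
  funMap := fun f => f.elim
  RelMap := fun R v => match R with
    | .home => ∃ x : N, v 0 = .real x
    | .rel R => ∃ t : Fin _ → N, v = (fun j => .real (t j)) ∧ FirstOrder.Language.Structure.RelMap R t
    | .graph f => ∃ t : Fin _ → N,
        v = Fin.snoc (fun j => .real (t j)) (.real (FirstOrder.Language.Structure.funMap f t))
    | .proj S => ∃ t : Fin S.arity → N,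
        v = Fin.snoc (fun j => .real (t j)) (.imag S (Quotient.mk S.rel t))

end General

/-! ### The selector expansion -/

section Selectors

variable (L : FirstOrder.Language.{u, v}) (ι : Type w) (M : Type w)

/-- The relation symbols of the selector language of a relational language `L`: predicates for the
three sorts `P`, `P/E`, `Q`, the equivalence relation `E`, the graph of `f_E : P → P/E`, an
`(n+1)`-ary relation `R⁺(z, x₁, …, xₙ)` for each `n`-ary relation `R` of `L`, and the graph of
`π : P/E × Q → P`. -/
inductive SelectorRelations : ℕ → Type v
  | sortP : SelectorRelations 1
  | sortPE : SelectorRelations 1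
  | sortQ : SelectorRelations 1
  | equiv : SelectorRelations 2
  | toClass : SelectorRelations 2
  | plus {n : ℕ} (R : L.Relations n) : SelectorRelations (n + 1)
  | select : SelectorRelations 3

/-- The selector language `L^S`, with its three sorts placed in one universe. -/
def selectorLanguage : FirstOrder.Language.{0, v} :=
  ⟨fun _ => Empty, SelectorRelations L⟩

/-- The universe of `M^S` with the `E`-classes indexed by `ι`: `pt i x` is the point of sort `P`
which is the copy of `x ∈ M` in the class `i`, `cls i` is the class `i` as an element of `P/E`, and
`sel s` is the element of `Q` given by the section `i ↦ pt i (s i)`. So `Q` consists of all sections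
of `f_E`. -/
inductive SelectorExpansion : Type w
  | pt (i : ι) (x : M) : SelectorExpansion
  | cls (i : ι) : SelectorExpansion
  | sel (s : ι → M) : SelectorExpansion

instance selectorStructure [L.Structure M] :
    (selectorLanguage L).Structure (SelectorExpansion ι M) where
  funMap := fun f => f.elim
  RelMap := fun R v => match R with
    | .sortP => ∃ i x, v 0 = .pt i x
    | .sortPE => ∃ i, v 0 = .cls i
    | .sortQ => ∃ s, v 0 = .sel s
    | .equiv => ∃ i x y, v 0 = .pt i x ∧ v 1 = .pt i y
    | .toClass => ∃ i x, v 0 = .pt i x ∧ v 1 = .cls i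
    | .plus R => ∃ (i : ι) (t : Fin _ → M),
        v = Fin.cons (.cls i) (fun j => .pt i (t j)) ∧ FirstOrder.Language.Structure.RelMap R t
    | .select => ∃ i s, v 0 = .cls i ∧ v 1 = .sel s ∧ v 2 = .pt i (s i)

end Selectors

/-! ### Dense linear orders -/

section Order

variable (ι : Type w) (M : Type w) [FirstOrder.Language.order.Structure M]

/-- The language of `(M^S)^eq` for an ordered structure `M`. -/
abbrev OrderEqLanguage : FirstOrder.Language.{0, w} :=
  eqLanguage (selectorLanguage FirstOrder.Language.order) (SelectorExpansion ι M)

/-- The structure `(M^S)^eq` for an ordered structure `M`. -/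
abbrev OrderEq : Type w :=
  WithImaginaries (selectorLanguage FirstOrder.Language.order) (SelectorExpansion ι M)

variable {ι M}

/-- The copy of `x ∈ M` in the class `i`, as an element of `(M^S)^eq`. -/
def point (i : ι) (x : M) : OrderEq ι M := .real (.pt i x)

/-- The selector `s ∈ Q`, as an element of `(M^S)^eq`. -/
def selector (s : ι → M) : OrderEq ι M := .real (.sel s)

variable (ι M)

/-- The symbol `≤⁺(z, x₁, x₂)` in the language of `(M^S)^eq`. -/
def lePlus : (OrderEqLanguage ι M).Relations 3 :=
  EqRelations.rel (L := selectorLanguage FirstOrder.Language.order)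
    (SelectorRelations.plus (L := FirstOrder.Language.order) FirstOrder.Language.leSymb)

/-- The formula `x > y`, that is, `x ≠ y` and `≤⁺(z, y, x)` holds for some class `z`. -/
def gtFormula : (OrderEqLanguage ι M).Formula (Fin 2) :=
  FirstOrder.Language.BoundedFormula.ex
    ((lePlus ι M).boundedFormula
      ![FirstOrder.Language.Term.var (Sum.inr 0), FirstOrder.Language.Term.var (Sum.inl 1),
        FirstOrder.Language.Term.var (Sum.inl 0)]) ⊓
  (FirstOrder.Language.Term.equal (FirstOrder.Language.Term.var 0)
    (FirstOrder.Language.Term.var 1)).not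

variable {ι M}

/-- The set defined by `x > a` in the class `i`, identified with `M`. -/
def gtSet [Preorder M] (i : ι) (a : M) : Set (OrderEq ι M) := point i '' Set.Ioi a

theorem relMap_lePlus [LinearOrder M] [FirstOrder.Language.order.OrderedStructure M]
    (v : Fin 3 → OrderEq ι M) :
    FirstOrder.Language.Structure.RelMap (lePlus ι M) v ↔
      ∃ (j : ι) (x y : M), v 0 = .real (.cls j) ∧ v 1 = point j x ∧ v 2 = point j y ∧ x ≤ y := by
  constructor
  · rintro ⟨t, rfl, j, u, rfl, hu⟩
    exact ⟨j, u 0, u 1, rfl, rfl, rfl, (FirstOrder.Language.relMap_leSymb u).1 hu⟩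
  · rintro ⟨j, x, y, h0, h1, h2, hxy⟩
    refine ⟨Fin.cons (.cls j) (fun k => .pt j (![x, y] k)), ?_, j, ![x, y], rfl,
      (FirstOrder.Language.relMap_leSymb ![x, y]).2 hxy⟩
    funext k
    fin_cases k
    · exact h0
    · exact h1
    · exact h2

/-- The formula `x > y`, instantiated at the point `a` of the class `i`, defines `gtSet i a`. -/
theorem setOf_gtFormula [LinearOrder M] [FirstOrder.Language.order.OrderedStructure M]
    (i : ι) (a : M) :
    {x | (gtFormula ι M).Realize ![x, point i a]} = gtSet i a := by
  ext x
  simp only [gtFormula, Set.mem_ofPred_eq, FirstOrder.Language.Formula.Realize,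
    FirstOrder.Language.BoundedFormula.realize_inf,
    FirstOrder.Language.BoundedFormula.realize_not, FirstOrder.Language.BoundedFormula.realize_ex]
  have h2 : FirstOrder.Language.BoundedFormula.Realize
      ((FirstOrder.Language.Term.var 0).equal (FirstOrder.Language.Term.var 1) :
        (OrderEqLanguage ι M).Formula (Fin 2)) ![x, point i a] default ↔ x = point i a :=
    FirstOrder.Language.Formula.realize_equal
  rw [h2]
  simp only [FirstOrder.Language.BoundedFormula.realize_rel, relMap_lePlus]
  constructor
  · rintro ⟨⟨z, j, y, m, h0, h, h', hle⟩, hne⟩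
    change x = point j m at h'
    change point i a = point j y at h
    subst h'
    simp only [point, WithImaginaries.real.injEq, SelectorExpansion.pt.injEq] at h
    obtain ⟨rfl, rfl⟩ := h
    exact ⟨m, lt_of_le_of_ne hle (fun h => hne (by rw [h])), rfl⟩
  · rintro ⟨m, hm, rfl⟩
    refine ⟨⟨_, i, a, m, rfl, rfl, rfl, le_of_lt hm⟩, ?_⟩
    intro h
    simp only [point, WithImaginaries.real.injEq, SelectorExpansion.pt.injEq, true_and] at h
    exact (ne_of_gt hm) h

end Order

end SelectorTheory

open SelectorTheory

/-!
The wreath product of `Aut(M)` by `Sym(ι)` acts on `M^S`, because `Q` consists of *all* sections,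
and hence on `(M^S)^eq`; definable sets are invariant under it. As `M` is a strongly homogeneous
dense linear order, `Aut(M)` acts transitively on increasing pairs: finite tuples of the same order
type satisfy the same formulas (`realize_iff_of_le_iff_le`, by back-and-forth).

An invariant equivalence relation on `P` which is not equality contains `E`
(`related_of_invariant`). For `e ∈ dcl(a)`, written `e = f(a)` with `f` definable without
parameters, apply this to the relation `f(p) = f(q)`: either `f` is injective on `P`, and then
`a ∈ dcl(e)`, or `f` is constant on the class of `a`, and then every automorphism fixing that class
fixes `e` (`apply_eq_self_of_mem_dcl`). So if `C ⊆ dcl(a)` and `a ∉ acl(C)`, then all automorphisms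
of `M`, acting on every class simultaneously, fix `C` pointwise. Those fixing a given `b > a` move
`a` to every point below `b`, so the canonical parameter of `x > a` is not in `acl(C, b)`
(`not_isWeaklyNormalOver`). Also, all points of the class of `a` are conjugates of `a` over `C`, and
any finitely many of the corresponding final segments meet (`not_stronglyDividesOver`).

The selector `d` with constant value `a` behaves differently. Over `d`, any point of the class of
`a` determines `a`, as the point of this class in the range of `d`. But permuting the classes fixes
`d` and moves `a` to the points of the range of `d`, one in each of the infinitely many classes,
while distinct classes have disjoint final segments.
-/

namespace SelectorTheory

/-! ### Homogeneity of dense linear orders -/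

section Homogeneity

/-- The automorphism group of `M` acts transitively on increasing pairs. -/
def IsPairHomogeneous (M : Type u) [LT M] [Language.order.Structure M] : Prop :=
  ∀ ⦃a b c d : M⦄, a < b → c < d → ∃ σ : M ≃[Language.order] M, σ a = c ∧ σ b = d

theorem IsPairHomogeneous.exists_apply_eq {M : Type u} [LinearOrder M] [NoMaxOrder M]
    [Language.order.Structure M] (hM : IsPairHomogeneous M) (a b : M) :
    ∃ σ : M ≃[Language.order] M, σ a = b := by
  obtain ⟨a', ha⟩ := exists_gt a
  obtain ⟨b', hb⟩ := exists_gt b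
  obtain ⟨σ, h, -⟩ := hM ha hb
  exact ⟨σ, h⟩

variable {M : Type u} [LinearOrder M]

/-- The extension step of the back-and-forth argument: a finite partial isomorphism of a dense
linear order without endpoints extends to any further point. -/
theorem exists_extension [DenselyOrdered M] [NoMinOrder M] [NoMaxOrder M] {γ : Type*} [Finite γ]
    (p q : γ → M) (h : ∀ i j, p i ≤ p j ↔ q i ≤ q j) (m : M) :
    ∃ m' : M, ∀ i, (p i ≤ m ↔ q i ≤ m') ∧ (m ≤ p i ↔ m' ≤ q i) := by
  classical
  cases nonempty_fintype γ
  by_cases hm : ∃ j, p j = m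
  · obtain ⟨j, rfl⟩ := hm
    exact ⟨q j, fun i => ⟨h i j, h j i⟩⟩
  · push Not at hm
    have : Nonempty M := ⟨m⟩
    obtain ⟨m', hlo, hhi⟩ := Order.exists_between_finsets
      ((Finset.univ.filter fun i => p i < m).image q)
      ((Finset.univ.filter fun i => m < p i).image q) (by
        simp only [Finset.mem_image, Finset.mem_filter, Finset.mem_univ, true_and]
        rintro _ ⟨i, hi, rfl⟩ _ ⟨j, hj, rfl⟩
        exact not_le.1 fun hle => not_lt.2 ((h j i).2 hle) (hi.trans hj))
    simp only [Finset.mem_image, Finset.mem_filter, Finset.mem_univ, true_and,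
      forall_exists_index, and_imp, forall_apply_eq_imp_iff₂] at hlo hhi
    refine ⟨m', fun i => ?_⟩
    rcases lt_or_gt_of_ne (hm i) with hi | hi
    · simp [hi.le, (hlo i hi).le, not_le.2 hi, not_le.2 (hlo i hi)]
    · simp [hi.le, (hhi i hi).le, not_le.2 hi, not_le.2 (hhi i hi)]

variable [Language.order.Structure M] [Language.order.OrderedStructure M]

/-- Finite tuples of the same order type in a dense linear order without endpoints satisfy the same
formulas. -/
theorem realize_iff_of_le_iff_le [DenselyOrdered M] [NoMinOrder M] [NoMaxOrder M] {α : Type*}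
    [Finite α] {n : ℕ} (φ : Language.order.BoundedFormula α n) (v w : α → M) (xs ys : Fin n → M)
    (h : ∀ i j, Sum.elim v xs i ≤ Sum.elim v xs j ↔ Sum.elim w ys i ≤ Sum.elim w ys j) :
    φ.Realize v xs ↔ φ.Realize w ys := by
  have extend : ∀ {n : ℕ} (v w : α → M) (xs ys : Fin n → M),
      (∀ i j, Sum.elim v xs i ≤ Sum.elim v xs j ↔ Sum.elim w ys i ≤ Sum.elim w ys j) →
      ∀ m, ∃ m', ∀ i j, Sum.elim v (Fin.snoc xs m : Fin (n + 1) → M) i ≤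
        Sum.elim v (Fin.snoc xs m : Fin (n + 1) → M) j ↔
        Sum.elim w (Fin.snoc ys m' : Fin (n + 1) → M) i ≤
        Sum.elim w (Fin.snoc ys m' : Fin (n + 1) → M) j := by
    intro n v w xs ys h m
    obtain ⟨m', hm'⟩ := exists_extension _ _ h m
    refine ⟨m', ?_⟩
    have hl := fun i => hm' (Sum.inl i)
    have hr := fun i => hm' (Sum.inr i)
    have hll := fun i j => h (Sum.inl i) (Sum.inl j)
    have hlr := fun i j => h (Sum.inl i) (Sum.inr j)
    have hrl := fun i j => h (Sum.inr i) (Sum.inl j)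
    have hrr := fun i j => h (Sum.inr i) (Sum.inr j)
    simp only [Sum.elim_inl, Sum.elim_inr] at hl hr hll hlr hrl hrr
    rintro (i | i) (j | j)
    · exact hll i j
    · refine Fin.lastCases ?_ (fun j => ?_) j <;> simp [hl, hlr]
    · refine Fin.lastCases ?_ (fun i => ?_) i <;> simp [hl, hrl]
    · refine Fin.lastCases ?_ (fun i => ?_) i <;> refine Fin.lastCases ?_ (fun j => ?_) j <;>
        simp [hr, hrr]
  have term : ∀ {n : ℕ} (t : Language.order.Term (α ⊕ Fin n)), ∃ i, t = Language.Term.var i := by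
    rintro n (i | ⟨f, _⟩)
    · exact ⟨i, rfl⟩
    · exact isEmptyElim f
  induction φ with
  | falsum => rfl
  | equal t₁ t₂ =>
    obtain ⟨i, rfl⟩ := term t₁
    obtain ⟨j, rfl⟩ := term t₂
    simp only [Language.BoundedFormula.Realize, Language.Term.realize_var]
    rw [le_antisymm_iff, le_antisymm_iff, h i j, h j i]
  | rel R ts =>
    cases R
    obtain ⟨i, hi⟩ := term (ts 0)
    obtain ⟨j, hj⟩ := term (ts 1)
    refine (Language.relMap_leSymb (L := Language.order) _).trans
      (Iff.trans ?_ (Language.relMap_leSymb (L := Language.order) _).symm)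
    simp only [hi, hj, Language.Term.realize_var]
    exact h i j
  | imp _ _ ih₁ ih₂ =>
    simp only [Language.BoundedFormula.realize_imp, ih₁ xs ys h, ih₂ xs ys h]
  | all φ ih =>
    simp only [Language.BoundedFormula.realize_all]
    constructor
    · intro H m
      obtain ⟨m', hm'⟩ := extend w v ys xs (fun i j => (h i j).symm) m
      exact (ih _ _ fun i j => (hm' i j).symm).1 (H m')
    · intro H m
      obtain ⟨m', hm'⟩ := extend v w xs ys h m
      exact (ih _ _ hm').2 (H m')

/-- Strong homogeneity is stated for elementary maps; between pairs, these are the order-preserving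
maps. -/
theorem isPairHomogeneous_of_isStronglyHomogeneous [Language.order.dlo.Model M]
    {κ : Cardinal.{u}} (hκ : ℵ₀ ≤ κ) (hhom : IsStronglyHomogeneous Language.order M κ) :
    IsPairHomogeneous M := by
  intro a b c d hab hcd
  classical
  have := Language.order.denselyOrdered_of_dlo M
  have := Language.order.noBotOrder_of_dlo M
  have := Language.order.noTopOrder_of_dlo M
  have := NoBotOrder.to_noMinOrder M
  have := NoTopOrder.to_noMaxOrder M
  let f : ({a, b} : Set M) → M := fun x => if x.1 = a then c else d
  obtain ⟨σ, hσ⟩ := hhom {a, b} (((Set.toFinite _).lt_aleph0).trans_le hκ) f (fun φ =>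
    realize_iff_of_le_iff_le φ _ _ _ _ (by
      rintro (⟨i, rfl | rfl⟩ | i) (⟨j, rfl | rfl⟩ | j)
      all_goals first
        | exact i.elim0
        | exact j.elim0
        | simp [f, hab.ne', hab.le, hab.not_ge, hcd.not_ge, hcd.le]))
  refine ⟨σ, ?_, ?_⟩
  · simpa [f] using hσ ⟨a, by simp⟩
  · simpa [f, hab.ne'] using hσ ⟨b, by simp⟩

end Homogeneity

/-! ### Automorphisms and definable sets -/

section Automorphisms

variable {L : FirstOrder.Language.{u, v}} {N : Type w} [L.Structure N]

theorem mem_iff_of_definable {A : Set N} {α : Type*} {s : Set (α → N)} (hs : A.Definable L s)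
    (σ : N ≃[L] N) (hσ : ∀ x ∈ A, σ x = x) (v : α → N) : σ ∘ v ∈ s ↔ v ∈ s := by
  obtain ⟨φ, rfl⟩ := Set.definable_iff_exists_formula_sum.1 hs
  have : Sum.elim (↑) (σ ∘ v) = σ ∘ Sum.elim ((↑) : A → N) v := by
    funext x
    rcases x with x | x
    · exact (hσ x x.2).symm
    · rfl
  simp only [Set.mem_ofPred_eq, this]
  exact Language.StrongHomClass.realize_formula σ φ

theorem mem_iff_of_definable₁ {A : Set N} {s : Set N} (hs : A.Definable₁ L s)
    (σ : N ≃[L] N) (hσ : ∀ x ∈ A, σ x = x) (x : N) : σ x ∈ s ↔ x ∈ s :=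
  mem_iff_of_definable hs σ hσ fun _ => x

theorem sameTypeOver_of_fixes {A : Set N} (σ : N ≃[L] N) (hσ : ∀ x ∈ A, σ x = x) (b : N) :
    SameTypeOver L A (σ b) b :=
  fun _ hs => mem_iff_of_definable₁ hs σ hσ b

theorem eq_of_mem_dcl {A : Set N} {e : N} (he : e ∈ dcl L A) (σ : N ≃[L] N)
    (hσ : ∀ x ∈ A, σ x = x) : σ e = e :=
  (mem_iff_of_definable₁ he σ hσ e).2 rfl

/-- An element with infinitely many conjugates over `A` is not algebraic over `A`. -/
theorem notMem_acl_of_infinite {A : Set N} {e : N} {Y : Set N} (hY : Y.Infinite)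
    (h : ∀ y ∈ Y, ∃ σ : N ≃[L] N, (∀ x ∈ A, σ x = x) ∧ σ e = y) : e ∉ acl L A := by
  rintro ⟨s, hfin, hes, hs⟩
  refine hY (hfin.subset fun y hy => ?_)
  obtain ⟨σ, hσ, rfl⟩ := h y hy
  exact (mem_iff_of_definable₁ hs σ hσ e).2 hes

theorem dcl_subset_acl {A B : Set N} (hAB : A ⊆ B) : dcl L A ⊆ acl L B :=
  fun x hx => ⟨{x}, Set.finite_singleton x, rfl, Set.Definable.mono hx hAB⟩

theorem definable₁_inter {A s t : Set N} (hs : A.Definable₁ L s) (ht : A.Definable₁ L t) :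
    A.Definable₁ L (s ∩ t) :=
  Set.Definable.inter hs ht

theorem mem_dcl_of_definable₁ {A s : Set N} {e : N} (hs : A.Definable₁ L s)
    (h : ∀ x, x ∈ s ↔ x = e) : e ∈ dcl L A := by
  obtain rfl : s = {e} := Set.ext h
  exact hs

theorem definable₁_of_formula {A : Set N} (φ : L.Formula (Fin 2)) {e : N} (he : e ∈ A) :
    A.Definable₁ L {x | φ.Realize ![x, e]} := by
  refine Set.definable_iff_exists_formula_sum.2
    ⟨φ.relabel ![Sum.inr 0, Sum.inl ⟨e, he⟩], ?_⟩
  ext x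
  change φ.Realize ![x 0, e] ↔ _
  simp only [Set.mem_ofPred_eq, Language.Formula.realize_relabel]
  congr! 1
  funext k
  fin_cases k <;> rfl

theorem exists_formula_of_mem_dcl {a e : N} (he : e ∈ dcl L {a}) :
    ∃ φ : L.Formula (Fin 2), ∀ x, φ.Realize ![a, x] ↔ x = e := by
  obtain ⟨φ, hφ⟩ := Set.definable_iff_exists_formula_sum.1 he
  refine ⟨φ.relabel (Sum.elim (fun _ => 0) fun _ => 1), fun x => ?_⟩
  have h := Set.ext_iff.1 hφ fun _ => x
  refine Iff.trans ?_ h.symm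
  simp only [Set.mem_ofPred_eq, Language.Formula.realize_relabel]
  congr! 1
  funext k
  rcases k with ⟨k, rfl⟩ | k <;> rfl

theorem realize_equiv_iff (σ : N ≃[L] N) (φ : L.Formula (Fin 2)) (x y : N) :
    φ.Realize ![σ x, σ y] ↔ φ.Realize ![x, y] := by
  rw [← Language.StrongHomClass.realize_formula σ φ (v := ![x, y])]
  congr! 1
  funext k
  fin_cases k <;> rfl

/-- The action of an automorphism on the classes of a `∅`-definable equivalence relation. -/
def imaginaryMap (σ : N ≃[L] N) (S : ImaginarySort L N) : Quotient S.rel → Quotient S.rel :=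
  Quotient.map (fun t => σ ∘ t) fun t t' h =>
    (mem_iff_of_definable S.definable σ (by simp) (Sum.elim t t')).2 h

/-- The action of an automorphism of `N` on the universe of `N^eq`. -/
def withImaginariesMap (σ : N ≃[L] N) : WithImaginaries L N → WithImaginaries L N
  | .real x => .real (σ x)
  | .imag S q => .imag S (imaginaryMap σ S q)

theorem withImaginariesMap_leftInverse (σ τ : N ≃[L] N) (h : ∀ x, σ (τ x) = x) :
    Function.LeftInverse (withImaginariesMap σ) (withImaginariesMap τ) := by
  rintro (x | ⟨S, q⟩)
  · exact congrArg _ (h x)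
  · induction q using Quotient.inductionOn with
    | h t =>
      have : σ ∘ τ ∘ t = t := funext fun k => h (t k)
      change WithImaginaries.imag S (Quotient.mk S.rel (σ ∘ τ ∘ t)) = _
      rw [this]

theorem withImaginariesMap_relMap (σ : N ≃[L] N) {n : ℕ} (R : (eqLanguage L N).Relations n)
    (v : Fin n → WithImaginaries L N) (h : Language.Structure.RelMap R v) :
    Language.Structure.RelMap R (withImaginariesMap σ ∘ v) := by
  cases R with
  | home =>
    obtain ⟨x, hx⟩ := h
    exact ⟨σ x, by simp [hx, withImaginariesMap]⟩
  | rel R =>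
    obtain ⟨t, rfl, ht⟩ := h
    exact ⟨σ ∘ t, rfl, (Language.StrongHomClass.map_rel σ R t).2 ht⟩
  | graph f =>
    obtain ⟨t, rfl⟩ := h
    refine ⟨σ ∘ t, ?_⟩
    rw [Fin.comp_snoc, ← Language.HomClass.map_fun σ f t]
    rfl
  | proj S =>
    obtain ⟨t, rfl⟩ := h
    refine ⟨σ ∘ t, ?_⟩
    rw [Fin.comp_snoc]
    rfl

/-- The extension of an automorphism of `N` to an automorphism of `N^eq`. -/
def withImaginariesEquiv (σ : N ≃[L] N) :
    WithImaginaries L N ≃[eqLanguage L N] WithImaginaries L N where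
  toFun := withImaginariesMap σ
  invFun := withImaginariesMap σ.symm
  left_inv := withImaginariesMap_leftInverse _ _ σ.symm_apply_apply
  right_inv := withImaginariesMap_leftInverse _ _ σ.apply_symm_apply
  map_fun' := fun f => f.elim
  map_rel' := fun R v => by
    refine ⟨fun h => ?_, withImaginariesMap_relMap σ R v⟩
    have := withImaginariesMap_relMap σ.symm R _ h
    rwa [← Function.comp_assoc,
      (withImaginariesMap_leftInverse _ _ σ.symm_apply_apply).comp_eq_id] at this

end Automorphisms

/-! ### Automorphisms of the selector expansion -/

section Wreath

variable {L : FirstOrder.Language.{u, v}} {ι M : Type w} [L.Structure M]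

/-- The action of the unrestricted wreath product of `Aut(M)` by `Sym(ι)` on `M^S`: the class `j`
is mapped to the class `τ j` through the automorphism `g j`. As `Q` consists of all sections, every
such map of `P` acts on `Q`. -/
def wreathMap (τ : Equiv.Perm ι) (g : ι → M ≃[L] M) :
    SelectorExpansion ι M → SelectorExpansion ι M
  | .pt j x => .pt (τ j) (g j x)
  | .cls j => .cls (τ j)
  | .sel s => .sel fun k => g (τ.symm k) (s (τ.symm k))

theorem wreathMap_leftInverse (τ : Equiv.Perm ι) (g : ι → M ≃[L] M) :
    Function.LeftInverse (wreathMap τ.symm fun k => (g (τ.symm k)).symm) (wreathMap τ g) := by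
  rintro (⟨j, x⟩ | j | s) <;> simp [wreathMap]

theorem wreathMap_rightInverse (τ : Equiv.Perm ι) (g : ι → M ≃[L] M) :
    Function.RightInverse (wreathMap τ.symm fun k => (g (τ.symm k)).symm) (wreathMap τ g) := by
  rintro (⟨j, x⟩ | j | s) <;> simp [wreathMap]

theorem wreathMap_relMap (τ : Equiv.Perm ι) (g : ι → M ≃[L] M) {n : ℕ}
    (R : (selectorLanguage L).Relations n) (v : Fin n → SelectorExpansion ι M)
    (h : Language.Structure.RelMap R v) : Language.Structure.RelMap R (wreathMap τ g ∘ v) := by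
  cases R with
  | sortP =>
    obtain ⟨i, x, h⟩ := h
    exact ⟨_, _, congrArg (wreathMap τ g) h⟩
  | sortPE =>
    obtain ⟨i, h⟩ := h
    exact ⟨_, congrArg (wreathMap τ g) h⟩
  | sortQ =>
    obtain ⟨s, h⟩ := h
    exact ⟨_, congrArg (wreathMap τ g) h⟩
  | equiv =>
    obtain ⟨i, x, y, h, h'⟩ := h
    exact ⟨_, _, _, congrArg (wreathMap τ g) h, congrArg (wreathMap τ g) h'⟩
  | toClass =>
    obtain ⟨i, x, h, h'⟩ := h
    exact ⟨_, _, congrArg (wreathMap τ g) h, congrArg (wreathMap τ g) h'⟩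
  | plus R =>
    obtain ⟨i, t, rfl, ht⟩ := h
    refine ⟨τ i, g i ∘ t, ?_, (Language.StrongHomClass.map_rel (g i) R t).2 ht⟩
    funext k
    refine Fin.cases rfl (fun k => rfl) k
  | select =>
    obtain ⟨i, s, h, h', h''⟩ := h
    refine ⟨_, _, congrArg (wreathMap τ g) h, congrArg (wreathMap τ g) h',
      (congrArg (wreathMap τ g) h'').trans ?_⟩
    simp [wreathMap]

/-- The automorphism of `M^S` given by an element of the wreath product. -/
def wreathEquiv (τ : Equiv.Perm ι) (g : ι → M ≃[L] M) :
    SelectorExpansion ι M ≃[selectorLanguage L] SelectorExpansion ι M where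
  toFun := wreathMap τ g
  invFun := wreathMap τ.symm fun k => (g (τ.symm k)).symm
  left_inv := wreathMap_leftInverse τ g
  right_inv := wreathMap_rightInverse τ g
  map_fun' := fun f => f.elim
  map_rel' := fun R v => by
    refine ⟨fun h => ?_, wreathMap_relMap τ g R v⟩
    have := wreathMap_relMap τ.symm (fun k => (g (τ.symm k)).symm) R _ h
    rwa [← Function.comp_assoc, (wreathMap_leftInverse τ g).comp_eq_id] at this

end Wreath

section OrderWreath

variable {ι M : Type u} [Language.order.Structure M]

/-- The automorphism of `(M^S)^eq` given by an element of the wreath product. -/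
def wreathAut (τ : Equiv.Perm ι) (g : ι → M ≃[Language.order] M) :
    OrderEq ι M ≃[OrderEqLanguage ι M] OrderEq ι M :=
  withImaginariesEquiv (wreathEquiv τ g)

theorem wreathAut_point (τ : Equiv.Perm ι) (g : ι → M ≃[Language.order] M) (j : ι) (x : M) :
    wreathAut τ g (point j x) = point (τ j) (g j x) := rfl

theorem point_eq_iff {i j : ι} {x y : M} : point i x = point j y ↔ i = j ∧ x = y := by
  simp [point]

/-- An invariant equivalence relation on `P` other than equality contains `E`. If the related
points lie in different classes, moving one of them inside its class gives two related points of one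
class, and by homogeneity of `M` all pairs of points of one class are then related. -/
theorem related_of_invariant [LinearOrder M] [NoMaxOrder M]
    (hM : IsPairHomogeneous M) (r : ι × M → ι × M → Prop) (symm : ∀ {p q}, r p q → r q p)
    (trans : ∀ {p q w}, r p q → r q w → r p w)
    (inv : ∀ (τ : Equiv.Perm ι) (g : ι → M ≃[Language.order] M) {p q : ι × M}, r p q →
      r (τ p.1, g p.1 p.2) (τ q.1, g q.1 q.2))
    {p q : ι × M} (hpq : r p q) (hne : p ≠ q) (k : ι) (x y : M) : r (k, x) (k, y) := by
  classical
  have refl : ∀ j x, r (j, x) (j, x) := by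
    intro j x
    obtain ⟨x', hx'⟩ := exists_gt x
    obtain ⟨y', hy'⟩ := exists_gt p.2
    obtain ⟨σ, hσ, -⟩ := hM hy' hx'
    simpa [hσ] using inv (Equiv.swap p.1 j) (fun _ => σ) (trans hpq (symm hpq))
  obtain ⟨j, u, v, huv, hlt⟩ : ∃ j u v, r (j, u) (j, v) ∧ u < v := by
    obtain ⟨i, x⟩ := p
    obtain ⟨j, y⟩ := q
    rcases eq_or_ne i j with rfl | hij
    · rcases lt_trichotomy x y with h | rfl | h
      · exact ⟨i, x, y, hpq, h⟩
      · exact absurd rfl hne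
      · exact ⟨i, y, x, symm hpq, h⟩
    · obtain ⟨y', hy'⟩ := exists_gt y
      obtain ⟨y'', hy''⟩ := exists_gt y'
      obtain ⟨σ, hσ, -⟩ := hM hy' hy''
      have := inv 1 (Function.update (fun _ => .refl _ _) j σ) hpq
      simp only [Equiv.Perm.coe_one, id, Function.update_self, Function.update_of_ne hij, hσ] at this
      exact ⟨j, y, y', trans (symm hpq) this, hy'⟩
  have main : ∀ x y, x < y → r (k, x) (k, y) := by
    intro x y hxy
    obtain ⟨σ, hx, hy⟩ := hM hlt hxy
    simpa [hx, hy] using inv (Equiv.swap j k) (fun _ => σ) huv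
  rcases lt_trichotomy x y with h | rfl | h
  · exact main x y h
  · exact refl k x
  · exact symm (main y x h)

/-! ### Definable sets of points and constant selectors -/

theorem definable₁_points (A : Set (OrderEq ι M)) :
    A.Definable₁ (OrderEqLanguage ι M) {x | ∃ j m, x = point j m} := by
  refine Set.Definable.mono (Set.empty_definable_iff.2
    ⟨Language.Relations.formula (L := OrderEqLanguage ι M)
      (EqRelations.rel (L := selectorLanguage Language.order) SelectorRelations.sortP)
      ![Language.Term.var 0], ?_⟩) (Set.empty_subset A)
  ext v
  simp only [Set.mem_ofPred_eq]
  constructor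
  · rintro ⟨j, m, h⟩
    exact ⟨![.pt j m], by funext k; fin_cases k; exact h, j, m, rfl⟩
  · rintro ⟨t, h, j, m, ht⟩
    exact ⟨j, m, (congrFun h 0).trans (congrArg _ ht)⟩

theorem definable₁_sameClass (i : ι) (b : M) {A : Set (OrderEq ι M)} (hA : point i b ∈ A) :
    A.Definable₁ (OrderEqLanguage ι M) {x | ∃ m, x = point i m} := by
  convert definable₁_of_formula (Language.Relations.formula (L := OrderEqLanguage ι M)
      (EqRelations.rel (L := selectorLanguage Language.order) SelectorRelations.equiv)
      ![Language.Term.var 0, Language.Term.var (1 : Fin 2)]) hA using 1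
  ext x
  simp only [Set.mem_ofPred_eq]
  constructor
  · rintro ⟨m, rfl⟩
    exact ⟨![.pt i m, .pt i b], by funext k; fin_cases k <;> rfl, i, m, b, rfl, rfl⟩
  · rintro ⟨t, h, j, m, m', h0, h1⟩
    have hx : x = .real (t 0) := congrFun h 0
    have hb : point i b = .real (t 1) := congrFun h 1
    rw [h1] at hb
    obtain ⟨rfl, -⟩ := point_eq_iff.1 hb
    exact ⟨m, by rw [hx, h0]; rfl⟩

/-- The range of the section `s` is definable over `s`. -/
theorem definable₁_range_selector (s : ι → M) {A : Set (OrderEq ι M)} (hA : selector s ∈ A) :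
    A.Definable₁ (OrderEqLanguage ι M) {x | ∃ j, x = point j (s j)} := by
  convert definable₁_of_formula (Language.BoundedFormula.ex
    (Language.Relations.boundedFormula (L := OrderEqLanguage ι M)
      (EqRelations.rel (L := selectorLanguage Language.order) SelectorRelations.select)
      ![Language.Term.var (Sum.inr 0), Language.Term.var (Sum.inl (1 : Fin 2)),
        Language.Term.var (Sum.inl 0)]) : (OrderEqLanguage ι M).Formula (Fin 2)) hA using 1
  ext x
  simp only [Set.mem_ofPred_eq, Language.Formula.Realize, Language.BoundedFormula.realize_ex]
  constructor
  · rintro ⟨j, rfl⟩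
    exact ⟨.real (.cls j), ![.cls j, .sel s, .pt j (s j)], by funext k; fin_cases k <;> rfl,
      j, s, rfl, rfl, rfl⟩
  · rintro ⟨z, t, h, j, s', h0, h1, h2⟩
    have hs : selector s = .real (t 1) := congrFun h 1
    have hx : x = .real (t 2) := congrFun h 2
    rw [h1] at hs
    simp only [selector, WithImaginaries.real.injEq, SelectorExpansion.sel.injEq] at hs
    subst hs
    exact ⟨j, by rw [hx, h2]; rfl⟩

theorem point_notMem_acl_selector [Infinite ι] (i : ι) (a : M) :
    point i a ∉ acl (OrderEqLanguage ι M) {selector fun _ => a} := by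
  classical
  have hinj : Function.Injective fun j : ι => (point j a : OrderEq ι M) := fun _ _ h =>
    (point_eq_iff.1 h).1
  -- Permutations of the classes fix the constant selector.
  refine notMem_acl_of_infinite (Set.infinite_range_of_injective hinj) ?_
  rintro _ ⟨j, rfl⟩
  refine ⟨wreathAut (Equiv.swap i j) fun _ => .refl _ _, ?_, ?_⟩
  · rintro _ rfl
    rfl
  · rw [wreathAut_point, Equiv.swap_apply_left]
    rfl

end OrderWreath

/-! ### Parameters in the definable closure of a point -/

section Points

variable {ι M : Type u} [LinearOrder M] [Language.order.Structure M]

theorem eq_of_gtSet_eq [DenselyOrdered M] [NoMaxOrder M] {i j : ι} {a b : M}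
    (h : gtSet i a = gtSet j b) : i = j ∧ a = b := by
  obtain ⟨x, hx⟩ := exists_gt a
  have hx' : point i x ∈ gtSet j b := h ▸ ⟨x, hx, rfl⟩
  obtain ⟨y, -, hy⟩ := hx'
  obtain ⟨rfl, -⟩ := point_eq_iff.1 hy
  refine ⟨rfl, ?_⟩
  have hinj : Function.Injective (point j : M → OrderEq ι M) := fun _ _ h =>
    (point_eq_iff.1 h).2
  exact Set.Ioi_injective (hinj.image_injective h)

theorem gtSet_nonempty [NoMaxOrder M] (i : ι) (a : M) : (gtSet i a).Nonempty :=
  (exists_gt a).elim fun x hx => ⟨_, x, hx, rfl⟩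

theorem exists_aut_point [NoMaxOrder M] (hM : IsPairHomogeneous M) (i j : ι) (a b : M) :
    ∃ σ : OrderEq ι M ≃[OrderEqLanguage ι M] OrderEq ι M, σ (point i a) = point j b := by
  classical
  obtain ⟨σ, h⟩ := hM.exists_apply_eq a b
  exact ⟨wreathAut (Equiv.swap i j) fun _ => σ, by rw [wreathAut_point, h, Equiv.swap_apply_left]⟩

/-- Each element of `dcl(a)` is either interdefinable with `a` or fixed by all automorphisms that
fix the class of `a`. For `e = f(a)` with `f` definable, `f(p) = f(q)` is an invariant equivalence
relation on `P`. If it is equality, then `a ∈ dcl(e)`, as `a` is the only `y ∈ P` with `f(y) = e`;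
otherwise `f` is constant on the class of `a`. -/
theorem apply_eq_self_of_mem_dcl [NoMaxOrder M] (hM : IsPairHomogeneous M) {i : ι} {a : M}
    {e : OrderEq ι M} (he : e ∈ dcl (OrderEqLanguage ι M) {point i a})
    (hae : point i a ∉ dcl (OrderEqLanguage ι M) {e})
    (σ : OrderEq ι M ≃[OrderEqLanguage ι M] OrderEq ι M) {b : M}
    (hσ : σ (point i a) = point i b) : σ e = e := by
  -- The value `f(σ a) = σ e` does not depend on the choice of `σ`.
  have well : ∀ σ τ : OrderEq ι M ≃[OrderEqLanguage ι M] OrderEq ι M,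
      σ (point i a) = τ (point i a) → σ e = τ e := by
    intro σ τ h
    have := eq_of_mem_dcl he (τ.symm.comp σ) (by
      rintro _ rfl
      rw [Language.Equiv.comp_apply, h, Language.Equiv.symm_apply_apply])
    rw [Language.Equiv.comp_apply] at this
    rw [← this, Language.Equiv.apply_symm_apply, this]
  let r : ι × M → ι × M → Prop := fun p q =>
    ∃ σ τ : OrderEq ι M ≃[OrderEqLanguage ι M] OrderEq ι M,
      σ (point i a) = point p.1 p.2 ∧ τ (point i a) = point q.1 q.2 ∧ σ e = τ e
  obtain ⟨p, hp, hr⟩ : ∃ p : ι × M, (i, a) ≠ p ∧ r (i, a) p := by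
    by_contra! hcon
    apply hae
    obtain ⟨φ, hφ⟩ := exists_formula_of_mem_dcl he
    refine mem_dcl_of_definable₁ (definable₁_inter (definable₁_points {e})
      (definable₁_of_formula φ (Set.mem_singleton e))) fun y => ⟨?_, ?_⟩
    · rintro ⟨⟨j, m, rfl⟩, hy⟩
      obtain ⟨σ, hσ⟩ := exists_aut_point hM i j a m
      have hσe : σ e = e := by
        rw [← hσ, ← σ.apply_symm_apply e] at hy
        have := (hφ _).1 ((realize_equiv_iff σ φ _ _).1 hy)
        exact (congrArg σ this).symm.trans (σ.apply_symm_apply e)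
      by_contra hne
      exact hcon (j, m) (fun h => hne (point_eq_iff.2 (Prod.mk.inj h)).symm)
        ⟨.refl _ _, σ, rfl, hσ, hσe.symm⟩
    · rintro rfl
      exact ⟨⟨i, a, rfl⟩, (hφ e).2 rfl⟩
  obtain ⟨σ', τ', hσ', hτ', heq⟩ := related_of_invariant hM r
    (fun ⟨σ, τ, h, h', h''⟩ => ⟨τ, σ, h', h, h''.symm⟩)
    (fun ⟨σ, τ, h, h', h''⟩ ⟨σ', τ', k, k', k''⟩ =>
      ⟨σ, τ', h, k', h''.trans ((well τ σ' (h'.trans k.symm)).trans k'')⟩)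
    (fun ρ g {p q} ⟨σ, τ, h, h', h''⟩ =>
      ⟨(wreathAut ρ g).comp σ, (wreathAut ρ g).comp τ,
        by rw [Language.Equiv.comp_apply, h, wreathAut_point],
        by rw [Language.Equiv.comp_apply, h', wreathAut_point],
        by rw [Language.Equiv.comp_apply, h'', Language.Equiv.comp_apply]⟩)
    hr hp i a b
  rw [well σ τ' (hσ.trans hτ'.symm), ← heq, well σ' (.refl _ _) hσ']
  rfl

/-- Over `C ⊆ dcl(a)` with `a ∉ acl(C)`, the automorphisms of `M` still act on the class of `a`. -/
theorem fixes_of_subset_dcl [NoMaxOrder M] (hM : IsPairHomogeneous M) {i : ι} {a : M}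
    {C : Set (OrderEq ι M)} (hC : C ⊆ dcl (OrderEqLanguage ι M) {point i a})
    (ha : point i a ∉ acl (OrderEqLanguage ι M) C) (g : M ≃[Language.order] M) :
    ∀ e ∈ C, wreathAut (1 : Equiv.Perm ι) (fun _ => g) e = e := fun _ he =>
  apply_eq_self_of_mem_dcl hM (hC he)
    (fun h => ha (dcl_subset_acl (Set.singleton_subset_iff.2 he) h)) _ (wreathAut_point _ _ _ _)

variable [Language.order.OrderedStructure M]

/-- Canonical parameters are moved by automorphisms along with the set. -/
theorem setOf_realize_map_eq_gtSet {φ : (OrderEqLanguage ι M).Formula (Fin 2)} {i j : ι} {a b : M}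
    {e : OrderEq ι M} (he : {x | φ.Realize ![x, e]} = gtSet i a)
    (σ : OrderEq ι M ≃[OrderEqLanguage ι M] OrderEq ι M) (hσ : σ (point i a) = point j b) :
    {x | φ.Realize ![x, σ e]} = gtSet j b := by
  rw [← setOf_gtFormula] at he ⊢
  ext x
  obtain ⟨x, rfl⟩ := σ.surjective x
  rw [← hσ]
  simpa only [Set.mem_ofPred_eq, realize_equiv_iff] using Set.ext_iff.1 he x

theorem isCanonicalParameter_point [DenselyOrdered M] [NoMaxOrder M] (i : ι) (a : M) :
    IsCanonicalParameter (OrderEqLanguage ι M) (gtSet i a) (point i a) := by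
  refine ⟨gtFormula ι M, setOf_gtFormula i a, fun e he => ?_⟩
  obtain ⟨x, hx⟩ := gtSet_nonempty i a
  -- A parameter for which `x > y` is satisfiable is a point, by the sorts of `≤⁺`.
  obtain ⟨j, b, rfl⟩ : ∃ j b, e = point j b := by
    rw [← he] at hx
    simp only [gtFormula, Set.mem_ofPred_eq, Language.Formula.Realize,
      Language.BoundedFormula.realize_inf, Language.BoundedFormula.realize_ex,
      Language.BoundedFormula.realize_rel, relMap_lePlus] at hx
    obtain ⟨⟨z, j, y, m, -, h, -⟩, -⟩ := hx
    exact ⟨j, y, h⟩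
  rw [setOf_gtFormula] at he
  exact point_eq_iff.2 (eq_of_gtSet_eq he)

theorem not_isWeaklyNormalOver [DenselyOrdered M] [NoMinOrder M] [NoMaxOrder M]
    (hM : IsPairHomogeneous M) {i : ι} {a : M}
    {C : Set (OrderEq ι M)} (hC : C ⊆ dcl (OrderEqLanguage ι M) {point i a})
    (ha : point i a ∉ acl (OrderEqLanguage ι M) C) :
    ¬ IsWeaklyNormalOver (OrderEqLanguage ι M) (gtSet i a) C := by
  rintro ⟨-, e, ⟨φ, hφ, -⟩, hacl⟩
  obtain ⟨b, hab⟩ := exists_gt a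
  -- The automorphisms of the class of `a` that fix `b` move `a`, and with it `e`, to infinitely
  -- many places below `b`.
  choose! g hga hgb using fun x (hx : x < b) => hM hab hx
  have hinj : Set.InjOn (fun x => wreathAut (1 : Equiv.Perm ι) (fun _ => g x) e) (Set.Iio b) := by
    intro x hx y hy hxy
    have hset : ∀ z < b, {w | φ.Realize ![w, wreathAut (1 : Equiv.Perm ι) (fun _ => g z) e]} =
        gtSet i z := fun z hz =>
      setOf_realize_map_eq_gtSet hφ _ (by rw [wreathAut_point, hga z hz, Equiv.Perm.one_apply])
    have := hset x hx
    dsimp only at hxy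
    rw [hxy, hset y hy] at this
    exact (eq_of_gtSet_eq this).2.symm
  refine notMem_acl_of_infinite ((Set.Iio_infinite b).image hinj) ?_ (hacl _ ⟨b, hab, rfl⟩)
  rintro _ ⟨x, hx, rfl⟩
  refine ⟨_, ?_, rfl⟩
  rintro _ (rfl | he)
  · rw [wreathAut_point, hgb x hx, Equiv.Perm.one_apply]
  · exact fixes_of_subset_dcl hM hC ha _ _ he

theorem not_stronglyDividesOver [NoMaxOrder M] (hM : IsPairHomogeneous M) {i : ι} {a : M}
    {C : Set (OrderEq ι M)} (hC : C ⊆ dcl (OrderEqLanguage ι M) {point i a}) :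
    ¬ StronglyDividesOver (OrderEqLanguage ι M) (gtFormula ι M) (point i a) C := by
  classical
  rintro ⟨ha, k, -, hk⟩
  have : Nonempty M := ⟨a⟩
  have : Infinite M := NoMaxOrder.infinite
  obtain ⟨T, hT⟩ := Infinite.exists_subset_card_eq M k
  obtain ⟨m, hm⟩ := T.exists_le
  obtain ⟨m', hm'⟩ := exists_gt m
  have hinj : Function.Injective (point i : M → OrderEq ι M) := fun _ _ h =>
    (point_eq_iff.1 h).2
  refine hk (T.map ⟨_, hinj⟩) (by rw [Finset.card_map, hT]) ?_ ⟨point i m', ?_⟩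
  · simp only [Finset.mem_map, Function.Embedding.coeFn_mk]
    rintro _ ⟨x, -, rfl⟩
    obtain ⟨g, rfl⟩ := hM.exists_apply_eq a x
    exact sameTypeOver_of_fixes _ (fixes_of_subset_dcl hM hC ha g) (point i a)
  · simp only [Finset.mem_map, Function.Embedding.coeFn_mk]
    rintro _ ⟨x, hx, rfl⟩
    change point i m' ∈ {y | (gtFormula ι M).Realize ![y, point i x]}
    rw [setOf_gtFormula]
    exact ⟨m', (hm x hx).trans_lt hm', rfl⟩

/-! ### Constant selectors -/

theorem isWeaklyNormalOver_selector [DenselyOrdered M] [NoMaxOrder M] (i : ι) (a : M) :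
    IsWeaklyNormalOver (OrderEqLanguage ι M) (gtSet i a) {selector fun _ => a} := by
  refine ⟨gtSet_nonempty i a, point i a, isCanonicalParameter_point i a, ?_⟩
  rintro _ ⟨b, -, rfl⟩
  refine dcl_subset_acl subset_rfl ?_
  refine mem_dcl_of_definable₁ (definable₁_inter
    (definable₁_sameClass i b (Set.mem_insert _ {selector fun _ => a}))
    (definable₁_range_selector (fun _ => a) (Set.mem_insert_of_mem (point i b) rfl)))
    fun y => ⟨?_, ?_⟩
  · rintro ⟨⟨m, rfl⟩, j, h⟩
    obtain ⟨-, rfl⟩ := point_eq_iff.1 h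
    rfl
  · rintro rfl
    exact ⟨⟨a, rfl⟩, i, rfl⟩

theorem stronglyDividesOver_selector [Infinite ι] (i : ι) (a : M) :
    StronglyDividesOver (OrderEqLanguage ι M) (gtFormula ι M) (point i a)
      {selector fun _ => a} := by
  classical
  refine ⟨point_notMem_acl_selector i a, 2, two_pos, ?_⟩
  rintro F hF htype ⟨x, hx⟩
  obtain ⟨p, q, hpq, rfl⟩ := Finset.card_eq_two.1 hF
  -- The conjugates of `a` lie in the range of the selector, which has one point in each class.
  have key : ∀ b ∈ ({p, q} : Finset (OrderEq ι M)), ∃ j, b = point j a ∧ x ∈ gtSet j a := by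
    intro b hb
    obtain ⟨j, rfl⟩ := (htype b hb _ (definable₁_range_selector _ rfl)).2 ⟨i, rfl⟩
    refine ⟨j, rfl, ?_⟩
    rw [← setOf_gtFormula]
    exact hx _ hb
  obtain ⟨j, rfl, y, -, rfl⟩ := key p (by simp)
  obtain ⟨k, rfl, z, -, hz⟩ := key q (by simp)
  exact hpq (by rw [(point_eq_iff.1 hz).1])

end Points

end SelectorTheory

theorem proposition4p7 {ι M : Type u} (κ : Cardinal.{u}) (hκ : Cardinal.aleph0 ≤ κ)
    (hι : Cardinal.mk ι = κ)
    [LinearOrder M] [FirstOrder.Language.order.Structure M]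
    [FirstOrder.Language.order.OrderedStructure M]
    [FirstOrder.Language.Theory.Model M FirstOrder.Language.order.dlo]
    (hsat : IsSaturated FirstOrder.Language.order M κ)
    (hhom : IsStronglyHomogeneous FirstOrder.Language.order M κ)
    (i : ι) (a : M) :
    -- the canonical parameter of `X` is `a`
    IsCanonicalParameter (OrderEqLanguage ι M)
      (gtSet i a) (point i a) ∧
    -- no `e` in the definable closure of `a`, imaginaries included, works
    (¬ ∃ e ∈ dcl (OrderEqLanguage ι M) {point i a},
      IsWeaklyNormalOver (OrderEqLanguage ι M)
        (gtSet i a) {e} ∧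
      point i a ∉ acl (OrderEqLanguage ι M) {e}) ∧
    -- nor does any set of such elements
    (¬ ∃ C ⊆ dcl (OrderEqLanguage ι M) {point i a},
      IsWeaklyNormalOver (OrderEqLanguage ι M)
        (gtSet i a) C ∧
      point i a ∉ acl (OrderEqLanguage ι M) C) ∧
    -- the formula `x > a` strongly divides over no subset of the definable closure of `a`
    (¬ ∃ C ⊆ dcl (OrderEqLanguage ι M) {point i a},
      StronglyDividesOver (OrderEqLanguage ι M)
        (gtFormula ι M) (point i a) C) ∧
    -- but some `d ∈ Q` works, and `x > a` strongly divides over `d`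
    ∃ s : ι → M,
      IsWeaklyNormalOver (OrderEqLanguage ι M)
        (gtSet i a) {selector s} ∧
      point i a ∉
        acl (OrderEqLanguage ι M) {selector s} ∧
      StronglyDividesOver (OrderEqLanguage ι M)
        (gtFormula ι M) (point i a) {selector s} := by
  have := Language.order.denselyOrdered_of_dlo M
  have := Language.order.noBotOrder_of_dlo M
  have := Language.order.noTopOrder_of_dlo M
  have := NoBotOrder.to_noMinOrder M
  have := NoTopOrder.to_noMaxOrder M
  have : Infinite ι := Cardinal.infinite_iff.2 (hι.symm ▸ hκ)
  have hM := isPairHomogeneous_of_isStronglyHomogeneous hκ hhom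
  exact ⟨isCanonicalParameter_point i a,
    fun ⟨_, he, hwn, ha⟩ => not_isWeaklyNormalOver hM (Set.singleton_subset_iff.2 he) ha hwn,
    fun ⟨_, hC, hwn, ha⟩ => not_isWeaklyNormalOver hM hC ha hwn,
    fun ⟨_, hC, h⟩ => not_stronglyDividesOver hM hC h,
    fun _ => a, isWeaklyNormalOver_selector i a, point_notMem_acl_selector i a,
    stronglyDividesOver_selector i a⟩
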